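/- Let $G$ be an amenable group generated by a finite set $\Sigma$, and let $\sigma$ be an inner automorphism of $G$ of order two. Let $(\pi_i : G \to G_i)_{i \in I}$ be an infinite family of finite quotients of $G$, i.e. each $\pi_i$ is a surjective homomorphism onto a finite group and infinitely many different kernels $\ker \pi_i$ occur. The automorphism of $G_i$ induced by $\sigma$ is again denoted by $\sigma$ (if $\sigma$ is conjugation by $g$, it is conjugation by $\pi_i(g)$). For a finite group $H$, a subset $S \subseteq H$ and an automorphism $\tau$ of $H$, the twisted Cayley graph $C(H,S)^\tau$ has vertex set $H$ and an edge from $x$ to $y$ if and only if $y = \tau(xs)$ for some $s \in S$. Then the twisted Cayley graphs $$C\bigl(G_i, \pi_i(\Sigma \cup \sigma(\Sigma^{-1}))\bigr)^\sigma, \qquad i \in I,$$ do not form an expander family: the nontrivial spectra of their normalised adjacency operators are not uniformly bounded away from $1$. That is, there is no $\varepsilon > 0$ such that for every $i \in I$ all eigenvalues of the normalised adjacency operator of the $i$-th graph on the functions $f : G_i \to \mathbb{R}$ with $\sum_{x \in G_i} f(x) = 0$ are at most $1 - \varepsilon$. -/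

import Mathlib

open scoped Pointwise

noncomputable section

/-- A discrete group is amenable if there is a left-invariant mean on the space of bounded
real-valued functions on it: a functional `m` that is linear, positive, normalised and
left-invariant on bounded functions (its values on unbounded functions play no role). -/
def IsAmenableGroup (G : Type*) [Group G] : Prop :=
  ∃ m : (G → ℝ) → ℝ,
    m (fun _ => 1) = 1 ∧
    (∀ f, (∃ C, ∀ x, |f x| ≤ C) → (∀ x, 0 ≤ f x) → 0 ≤ m f) ∧
    (∀ f₁ f₂, (∃ C, ∀ x, |f₁ x| ≤ C) → (∃ C, ∀ x, |f₂ x| ≤ C) →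
      m (fun x => f₁ x + f₂ x) = m f₁ + m f₂) ∧
    (∀ (c : ℝ) (f), (∃ C, ∀ x, |f x| ≤ C) → m (fun x => c * f x) = c * m f) ∧
    (∀ (g : G) (f), (∃ C, ∀ x, |f x| ≤ C) → m (fun x => f (g * x)) = m f)

/-- The twisted Cayley graph `C(H, S)^τ`: the vertices are the elements of `H`, and there is an
edge from `x` to `y` if `y = τ (x * s)` for some `s ∈ S` (loops are allowed). -/
def twistedCayleyGraph {H : Type*} [Group H] (τ : MulAut H) (S : Set H) : Digraph H where
  Adj x y := ∃ s ∈ S, y = τ (x * s)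

open Classical in
/-- The normalised adjacency operator of a finite graph: `f` is sent to the function whose value
at `x` is the average of `f` over the neighbours of `x`. -/
def normalisedAdjacency {V : Type*} [Fintype V] (Γ : Digraph V) : (V → ℝ) →ₗ[ℝ] (V → ℝ) :=
  Matrix.toLin' (Matrix.of fun x y =>
    if Γ.Adj x y then (((Finset.univ.filter fun z => Γ.Adj x z).card : ℝ))⁻¹ else 0)

/-- The nontrivial spectrum of the normalised adjacency operator of a finite undirected regular
graph: its eigenvalues on the functions orthogonal to the constants. So `1` belongs to it exactly
if the eigenvalue `1` has multiplicity at least two, that is, if the graph is not connected. -/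
def nontrivialSpectrum {V : Type*} [Fintype V] (Γ : Digraph V) : Set ℝ :=
  {μ | ∃ f : V → ℝ, f ≠ 0 ∧ ∑ x, f x = 0 ∧ normalisedAdjacency Γ f = μ • f}

/-- The nontrivial spectra of the normalised adjacency operators of the graphs of the family are
uniformly bounded away from `1`. -/
def IsExpanderFamily {ι : Type*} {V : ι → Type*} [∀ i, Fintype (V i)]
    (Γ : ∀ i, Digraph (V i)) : Prop :=
  ∃ ε : ℝ, 0 < ε ∧ ∀ i, ∀ μ ∈ nontrivialSpectrum (Γ i), μ ≤ 1 - ε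

/-- If `σ` is conjugation by `g`, the automorphism that `σ` induces on the image of a homomorphism
`π` is conjugation by `π g`. -/
theorem conj_map_apply {G H : Type*} [Group G] [Group H] (π : G →* H) (g x : G) :
    MulAut.conj (π g) (π x) = π (MulAut.conj g x) := by
  simp

end

/-! Since `σ` is inner, an edge step `x ↦ τ (x * s)` is the two-sided translation `x ↦ g x s g⁻¹`,
so it comes from the action of `G × G` on `G`. For a Følner set `F` of `G`, `F × F` is almost
invariant under the relevant pairs. Let `N y` count the pairs `(a, b)` in `F × F` with `π (a b⁻¹) =
y`; then `N` is almost invariant in `ℓ¹`, and `h = √N` in `ℓ²`. The support of `h` has at most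
`|F|²` points, so in a large quotient `h` is far from constant, against a spectral gap.

Large quotients exist because a finitely generated group has finitely many kernels of bounded index.
As `σ² = 1`, the generators are stable under `s ↦ σ s⁻¹`, which makes the adjacency operator
symmetric and lets the gap control its quadratic form. -/

/-! ### From an invariant mean to Følner sets -/

theorem mean_finset_sum {X κ : Type*} {m : (X → ℝ) → ℝ}
    (hadd : ∀ f₁ f₂, (∃ C, ∀ x, |f₁ x| ≤ C) → (∃ C, ∀ x, |f₂ x| ≤ C) →
      m (fun x => f₁ x + f₂ x) = m f₁ + m f₂)
    (hsmul : ∀ (c : ℝ) (f), (∃ C, ∀ x, |f x| ≤ C) → m (fun x => c * f x) = c * m f)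
    (s : Finset κ) (f : κ → X → ℝ) (hf : ∀ k, ∃ C, ∀ x, |f k x| ≤ C) :
    m (fun x => ∑ k ∈ s, f k x) = ∑ k ∈ s, m (f k) := by
  classical
  induction s using Finset.induction_on with
  | empty =>
    have := hsmul 0 (fun _ => 1) ⟨1, by simp⟩
    simpa using this
  | insert a s ha ih =>
    simp only [Finset.sum_insert ha]
    rw [hadd _ _ (hf a), ih]
    choose C hC using hf
    exact ⟨∑ k ∈ s, C k, fun x => (Finset.abs_sum_le_sum_abs _ _).trans
      (Finset.sum_le_sum fun k _ => hC k x)⟩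

open Classical in
/-- An amenable group does not admit a finite set that doubles every finite set. -/
theorem IsAmenableGroup.exists_card_mul_lt {G : Type*} [Group G] (hG : IsAmenableGroup G)
    (K : Finset G) : ∃ F : Finset G, (K * F).card < 2 * F.card := by
  by_contra! hK
  obtain ⟨m, hone, hpos, hadd, hsmul, hinv⟩ := hG
  -- Hall's theorem turns doubling into an injection `φ` of two copies of `G` into `G` with `φ (x,
  -- b) ∈ K x`: a paradoxical decomposition.
  obtain ⟨φ, hφ, hφK⟩ := (Finset.all_card_le_biUnion_card_iff_exists_injective
    (fun p : G × Bool => K * {p.1})).1 (by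
      intro s
      have h1 : s.card ≤ 2 * (s.image Prod.fst).card := by
        have : s ⊆ (s.image Prod.fst) ×ˢ (Finset.univ : Finset Bool) := by
          intro p hp
          simp only [Finset.mem_product, Finset.mem_univ, and_true]
          exact Finset.mem_image_of_mem _ hp
        have := Finset.card_le_card this
        simp only [Finset.card_product, Finset.card_univ, Fintype.card_bool] at this
        omega
      refine h1.trans ((hK _).trans (Finset.card_le_card ?_))
      intro y hy
      obtain ⟨k, hk, x, hx, rfl⟩ := Finset.mem_mul.1 hy
      obtain ⟨p, hp, rfl⟩ := Finset.mem_image.1 hx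
      exact Finset.mem_biUnion.2 ⟨p, hp, Finset.mul_mem_mul hk (Finset.mem_singleton_self _)⟩)
  let e : G × Bool → G → ℝ := fun q x => if φ (x, q.2) = q.1 * x then 1 else 0
  have he : ∀ q x, |e q x| ≤ 1 := fun q x => by
    simp only [e]; split_ifs <;> simp
  have hsum : ∀ b, ∑ k ∈ K, m (e (k, b)) = 1 := by
    intro b
    rw [← mean_finset_sum hadd hsmul K (fun k => e (k, b)) fun k => ⟨1, he _⟩, ← hone]
    congr 1
    funext x
    obtain ⟨k, hk, x', hx', hkx⟩ := Finset.mem_mul.1 (hφK (x, b))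
    obtain rfl := Finset.mem_singleton.1 hx'
    rw [Finset.sum_eq_single_of_mem k hk]
    · simp [e, ← hkx]
    · intro k' _ hne
      simp only [e, ← hkx, mul_left_inj, ite_eq_right_iff, one_ne_zero, imp_false]
      exact hne.symm
  -- Translating each piece `{x | φ (x, b) = k x}` by `k` preserves its mean and makes the pieces
  -- disjoint, as `φ` is injective. Their total mean is `2`, yet their indicators sum to at most
  -- `1`.
  let e' : G × Bool → G → ℝ := fun q x => e q (q.1⁻¹ * x)
  have htot : ∑ q ∈ K ×ˢ (Finset.univ : Finset Bool), m (e' q) = 2 := by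
    have : ∀ q, m (e' q) = m (e q) := fun q => hinv q.1⁻¹ (e q) ⟨1, he q⟩
    simp only [this]
    rw [Finset.sum_product_right]
    simp [hsum]
  rw [← mean_finset_sum hadd hsmul _ e' fun q => ⟨1, fun x => he _ _⟩] at htot
  set u : G → ℝ := fun x => ∑ q ∈ K ×ˢ (Finset.univ : Finset Bool), e' q x with hu
  have hu0 : ∀ x, 0 ≤ u x := fun x => Finset.sum_nonneg fun q _ => by
    simp only [e', e]; split_ifs <;> simp
  have hu1 : ∀ x, u x ≤ 1 := by
    intro x
    have hval : ∀ q, e' q x = if φ (q.1⁻¹ * x, q.2) = x then 1 else 0 := fun q => by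
      simp [e', e]
    simp only [hu, hval, Finset.sum_boole]
    rw [← Nat.cast_one, Nat.cast_le, Finset.card_le_one]
    intro p hp q hq
    have h := hφ ((Finset.mem_filter.1 hp).2.trans (Finset.mem_filter.1 hq).2.symm)
    simp only [Prod.mk.injEq, mul_left_inj, inv_inj] at h
    exact Prod.ext h.1 h.2
  have hub : ∃ C, ∀ x, |u x| ≤ C := ⟨1, fun x => by rw [abs_of_nonneg (hu0 x)]; exact hu1 x⟩
  have h1 := hpos (fun x => 1 + -1 * u x) ⟨1, fun x => by
    rw [abs_le]; constructor <;> linarith [hu0 x, hu1 x]⟩ fun x => by linarith [hu1 x]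
  rw [hadd _ _ ⟨1, by simp⟩ ⟨1, fun x => by
    rw [abs_le]; constructor <;> linarith [hu0 x, hu1 x]⟩, hsmul _ _ hub, hone, htot] at h1
  norm_num at h1

open Classical in
/-- The Følner condition for amenable groups. -/
theorem IsAmenableGroup.exists_folner {G : Type*} [Group G] (hG : IsAmenableGroup G)
    (K : Finset G) {δ : ℝ} (hδ : 0 < δ) :
    ∃ F : Finset G, ((K * F).card : ℝ) < (1 + δ) * F.card := by
  by_contra! hK
  -- Uniform expansion by `1 + δ` iterates, so some power of `K` would double every finite set.
  have hpow : ∀ (n : ℕ) (F : Finset G), (1 + δ) ^ n * F.card ≤ ((K ^ n * F).card : ℝ) := by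
    intro n
    induction n with
    | zero => intro F; simp
    | succ n ih =>
      intro F
      rw [pow_succ, pow_succ, mul_assoc, mul_assoc]
      refine le_trans ?_ (ih (K * F))
      gcongr
      exact hK F
  obtain ⟨n, hn⟩ := pow_unbounded_of_one_lt (2 : ℝ) (by linarith : 1 < 1 + δ)
  obtain ⟨F, hF⟩ := hG.exists_card_mul_lt (K ^ n)
  have h1 := hpow n F
  have h2 : ((K ^ n * F).card : ℝ) < 2 * F.card := by exact_mod_cast hF
  have h3 : (2 : ℝ) * F.card ≤ (1 + δ) ^ n * F.card := by gcongr
  linarith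

/-! ### Finite quotients and fibre counts -/

/-- A finitely generated group has only finitely many kernels of homomorphisms onto groups of
bounded order. -/
theorem finite_range_ker_of_card_le {G : Type*} [Group G] {A : Set G} (hA : A.Finite)
    (hgen : Subgroup.closure A = ⊤) {ι : Type*} (Q : ι → Type*) [∀ i, Group (Q i)]
    [∀ i, Fintype (Q i)] (π : ∀ i, G →* Q i) (n : ℕ) (hn : ∀ i, Fintype.card (Q i) ≤ n) :
    (Set.range fun i => (π i).ker).Finite := by
  have := hA.to_subtype
  have hfin : Finite (G →* Equiv.Perm (Fin n)) :=
    Finite.of_injective (fun f (a : A) => f a) fun f f' h =>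
      MonoidHom.eq_of_eqOn_dense hgen fun a ha => congrFun h ⟨a, ha⟩
  refine (Set.finite_range fun f : G →* Equiv.Perm (Fin n) => f.ker).subset ?_
  rintro _ ⟨i, rfl⟩
  have ⟨j⟩ : Nonempty (Q i ↪ Fin n) :=
    Function.Embedding.nonempty_of_card_le (by simpa using hn i)
  -- Cayley's embedding puts all the quotients into one finite group.
  let ψ : Q i →* Equiv.Perm (Fin n) :=
    (Equiv.Perm.viaEmbeddingHom j).comp (MulAction.toPermHom (Q i) (Q i))
  have hψ : Function.Injective ψ :=
    (Equiv.Perm.viaEmbeddingHom_injective j).comp MulAction.toPerm_injective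
  exact ⟨ψ.comp (π i), MonoidHom.ker_comp_of_injective (π i) ψ hψ⟩

/-- Fibre counts of two finite sets under a map differ in `ℓ¹` by at most the size of the
symmetric difference of the sets. -/
theorem sum_abs_card_fiber_sub_le {α β : Type*} [DecidableEq α] [DecidableEq β] [Fintype β]
    (p : α → β) (P P' : Finset α) :
    ∑ y, |(((P.filter fun a => p a = y).card : ℝ)) - ((P'.filter fun a => p a = y).card : ℝ)| ≤
      ((P \ P').card : ℝ) + ((P' \ P).card : ℝ) := by
  have key : ∀ R R' : Finset α, ∀ y, ((R.filter fun a => p a = y).card : ℝ) =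
      (((R ∩ R').filter fun a => p a = y).card : ℝ) +
        (((R \ R').filter fun a => p a = y).card : ℝ) := by
    intro R R' y
    rw [← Nat.cast_add, ← Finset.card_union_of_disjoint, ← Finset.filter_union,
      Finset.union_comm, Finset.sdiff_union_inter]
    exact (Finset.disjoint_sdiff_inter R R').symm.mono (Finset.filter_subset _ _)
      (Finset.filter_subset _ _)
  have hfib : ∀ R : Finset α, (R.card : ℝ) = ∑ y, ((R.filter fun a => p a = y).card : ℝ) := by
    intro R
    rw [← Nat.cast_sum, ← Finset.card_eq_sum_card_fiberwise (f := p) (t := Finset.univ) fun _ _ => by simp]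
  rw [hfib (P \ P'), hfib (P' \ P), ← Finset.sum_add_distrib]
  refine Finset.sum_le_sum fun y _ => ?_
  rw [key P P' y, key P' P y, Finset.inter_comm P' P, abs_le]
  have h1 : (0 : ℝ) ≤ (((P \ P').filter fun a => p a = y).card : ℝ) := Nat.cast_nonneg _
  have h2 : (0 : ℝ) ≤ (((P' \ P).filter fun a => p a = y).card : ℝ) := Nat.cast_nonneg _
  constructor <;> linarith

/-! ### Spectral gap and almost invariant functions -/

open Classical in
/-- A symmetric real matrix with row sums `1` all of whose eigenvalues on the functions of sum
zero are at most `1 - ε` satisfies the corresponding bound on quadratic forms. -/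
theorem dotProduct_mulVec_le_of_spectrum {V : Type*} [Fintype V] (B : Matrix V V ℝ)
    (hsymm : B.IsSymm) (hrow : ∀ x, ∑ y, B x y = 1) {ε : ℝ}
    (hB : ∀ (μ : ℝ) (f : V → ℝ), f ≠ 0 → ∑ x, f x = 0 → B.mulVec f = μ • f → μ ≤ 1 - ε)
    (h : V → ℝ) :
    h ⬝ᵥ B.mulVec h ≤ (1 - ε) * ∑ x, h x ^ 2 + ε / Fintype.card V * (∑ x, h x) ^ 2 := by
  rcases isEmpty_or_nonempty V with hV | hV
  · simp [dotProduct]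
  have hcard : (Fintype.card V : ℝ) ≠ 0 := by simp
  let J : Matrix V V ℝ := Matrix.of fun _ _ => 1
  -- The coefficient of `J` makes `D` kill constants, so an eigenvector with negative eigenvalue has
  -- sum zero and would violate the gap.
  let D : Matrix V V ℝ := (1 - ε) • (1 : Matrix V V ℝ) - B + (ε / Fintype.card V) • J
  have hJ : ∀ v : V → ℝ, J.mulVec v = fun _ => ∑ x, v x := fun v => by
    funext x; simp [J, Matrix.mulVec, dotProduct]
  have hD : ∀ v : V → ℝ, D.mulVec v =
      (1 - ε) • v - B.mulVec v + (ε / Fintype.card V) • fun _ => ∑ x, v x := fun v => by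
    simp only [D, Matrix.add_mulVec, Matrix.sub_mulVec, Matrix.smul_mulVec, Matrix.one_mulVec, hJ]
  have hDH : D.IsHermitian := by
    ext x y
    have := hsymm.apply x y
    simp [D, J, Matrix.conjTranspose_apply, Matrix.one_apply, this, eq_comm]
  have hsumB : ∀ v : V → ℝ, ∑ x, B.mulVec v x = ∑ x, v x := fun v => by
    simp only [Matrix.mulVec, dotProduct]
    rw [Finset.sum_comm]
    refine Finset.sum_congr rfl fun y _ => ?_
    rw [← Finset.sum_mul]
    simp_rw [hsymm.apply y, hrow, one_mul]
  have hpos : D.PosSemidef := by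
    rw [hDH.posSemidef_iff_eigenvalues_nonneg]
    intro j
    by_contra hlt
    simp only [Pi.zero_apply, not_le] at hlt
    have hv := hDH.mulVec_eigenvectorBasis j
    set l := hDH.eigenvalues j
    set v : V → ℝ := (hDH.eigenvectorBasis j).ofLp
    have hv0 : v ≠ 0 := by
      intro h0
      have := (hDH.eigenvectorBasis).orthonormal.ne_zero j
      exact this (by ext x; exact congrFun h0 x)
    rw [hD] at hv
    have hsum : ∑ x, v x = 0 := by
      have h1 := congrArg (fun u : V → ℝ => ∑ x, u x) hv
      simp only [Pi.add_apply, Pi.sub_apply, Pi.smul_apply, smul_eq_mul, Finset.sum_add_distrib,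
        Finset.sum_sub_distrib, ← Finset.mul_sum, hsumB, Finset.sum_const, Finset.card_univ,
        nsmul_eq_mul] at h1
      have h2 : l * ∑ x, v x = 0 := by
        rw [← h1]; field_simp; ring
      exact (mul_eq_zero.1 h2).resolve_left hlt.ne
    have h3 := hB (1 - ε - l) v hv0 hsum (by
      rw [hsum] at hv
      funext x
      have := congrFun hv x
      simp only [Pi.add_apply, Pi.sub_apply, Pi.smul_apply, smul_eq_mul] at this ⊢
      linarith)
    linarith
  have h4 := hpos.dotProduct_mulVec_nonneg h
  rw [hD] at h4
  have h5 : h ⬝ᵥ h = ∑ x, h x ^ 2 := Finset.sum_congr rfl fun x _ => (sq _).symm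
  have h6 : h ⬝ᵥ (fun _ => ∑ x, h x) = (∑ x, h x) ^ 2 := by
    simp [dotProduct, ← Finset.sum_mul, sq]
  simp only [star_trivial, dotProduct_add, dotProduct_sub, dotProduct_smul, smul_eq_mul, h5, h6]
    at h4
  linarith

/-- A translate of a Følner set almost covers it. -/
theorem card_sdiff_smul_le {G : Type*} [Group G] [DecidableEq G] {K F : Finset G} {δ : ℝ}
    (hF : ((K * F).card : ℝ) ≤ (1 + δ) * F.card) (h1 : 1 ∈ K) {k : G} (hk : k ∈ K) :
    ((F \ (k • F)).card : ℝ) ≤ δ * F.card ∧ (((k • F) \ F).card : ℝ) ≤ δ * F.card := by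
  have hcard : (F \ (k • F)).card = ((k • F) \ F).card := by
    have h2 := Finset.card_sdiff_add_card F (k • F)
    have h3 := Finset.card_sdiff_add_card (k • F) F
    rw [Finset.card_smul_finset, Finset.union_comm] at h2
    omega
  rw [hcard, and_self]
  have hsub : ((k • F) \ F) ∪ F ⊆ K * F := by
    intro x hx
    rw [Finset.sdiff_union_self_eq_union] at hx
    rcases Finset.mem_union.1 hx with hx | hx
    · obtain ⟨y, hy, rfl⟩ := Finset.mem_smul_finset.1 hx
      exact Finset.mul_mem_mul hk hy
    · simpa using Finset.mul_mem_mul h1 hx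
  have h4 := Finset.card_le_card hsub
  rw [Finset.card_union_of_disjoint Finset.sdiff_disjoint] at h4
  have h5 : (((k • F) \ F).card : ℝ) + F.card ≤ (K * F).card := by exact_mod_cast h4
  linarith

theorem card_product_sdiff_le {α : Type*} [DecidableEq α] (F R R' : Finset α) :
    ((F ×ˢ F) \ (R ×ˢ R')).card ≤ (F \ R).card * F.card + F.card * (F \ R').card := by
  rw [← Finset.card_product, ← Finset.card_product]
  refine (Finset.card_le_card fun p hp => ?_).trans (Finset.card_union_le _ _)
  simp only [Finset.mem_sdiff, Finset.mem_product, Finset.mem_union] at hp ⊢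
  tauto

open Classical in
/-- If a twisted Cayley graph has a spectral gap, a function that is almost invariant under all
its generators cannot have a small sum. -/
theorem twistedCayleyGraph_gap_bound {H : Type*} [Group H] [Fintype H] (τ : MulAut H)
    (hτ : ∀ x, τ (τ x) = x) (S : Finset H) (hS : ∀ s ∈ S, τ s⁻¹ ∈ S) (hne : S.Nonempty) {ε : ℝ}
    (hspec : ∀ μ ∈ nontrivialSpectrum (twistedCayleyGraph τ (S : Set H)), μ ≤ 1 - ε)
    (h : H → ℝ) {η : ℝ}
    (hη : ∀ s ∈ S, ∑ x, (h x - h (τ (x * s))) ^ 2 ≤ η * ∑ x, h x ^ 2) :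
    (1 - η / 2) * ∑ x, h x ^ 2 ≤
      (1 - ε) * ∑ x, h x ^ 2 + ε / Fintype.card H * (∑ x, h x) ^ 2 := by
  set Γ := twistedCayleyGraph τ (S : Set H) with hΓ
  have hcard0 : (S.card : ℝ) ≠ 0 := by exact_mod_cast hne.card_pos.ne'
  have hinj : ∀ x, Function.Injective fun s => τ (x * s) := fun x s t hst =>
    mul_left_cancel (τ.injective hst)
  have hnbr : ∀ x, (Finset.univ.filter fun z => Γ.Adj x z) = S.image fun s => τ (x * s) := by
    intro x
    ext z
    simp [hΓ, twistedCayleyGraph, eq_comm]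
  have hdeg : ∀ x, (Finset.univ.filter fun z => Γ.Adj x z).card = S.card := fun x => by
    rw [hnbr, Finset.card_image_of_injective _ (hinj x)]
  have hadj : ∀ x y, Γ.Adj x y → Γ.Adj y x := by
    rintro x y ⟨s, hs, rfl⟩
    refine ⟨τ s⁻¹, hS s hs, ?_⟩
    rw [map_mul, hτ, hτ, mul_inv_cancel_right]
  let B : Matrix H H ℝ := Matrix.of fun x y => if Γ.Adj x y then (S.card : ℝ)⁻¹ else 0
  have hB : ∀ f, normalisedAdjacency Γ f = B.mulVec f := by
    intro f
    simp only [normalisedAdjacency, Matrix.toLin'_apply, hdeg, B]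
  have hBf : ∀ (f : H → ℝ) x, B.mulVec f x = (S.card : ℝ)⁻¹ * ∑ s ∈ S, f (τ (x * s)) := by
    intro f x
    rw [← Finset.sum_image (f := f) fun s _ t _ hst => hinj x hst, ← hnbr, Finset.sum_filter,
      Finset.mul_sum]
    refine Finset.sum_congr rfl fun y _ => ?_
    simp only [B, Matrix.of_apply]
    split_ifs <;> simp
  have hrow : ∀ x, ∑ y, B x y = 1 := by
    intro x
    have := hBf (fun _ => 1) x
    simpa [Matrix.mulVec, dotProduct, hcard0] using this
  have hsymm : B.IsSymm := by
    ext x y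
    have : Γ.Adj y x ↔ Γ.Adj x y := ⟨hadj _ _, hadj _ _⟩
    simp [B, this]
  have hup := dotProduct_mulVec_le_of_spectrum B hsymm hrow (ε := ε)
    (fun μ f hf hsum hμ => hspec μ ⟨f, hf, hsum, (hB f).trans hμ⟩) h
  refine le_trans ?_ hup
  have hs : ∀ s ∈ S, (1 - η / 2) * ∑ x, h x ^ 2 ≤ ∑ x, h x * h (τ (x * s)) := by
    intro s hs
    have h1 := hη s hs
    have h2 : ∑ x, h (τ (x * s)) ^ 2 = ∑ x, h x ^ 2 :=
      ((Equiv.mulRight s).trans τ.toEquiv).sum_comp fun x => h x ^ 2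
    have h3 : ∑ x, (h x - h (τ (x * s))) ^ 2 =
        ∑ x, h x ^ 2 + ∑ x, h (τ (x * s)) ^ 2 - 2 * ∑ x, h x * h (τ (x * s)) := by
      rw [Finset.mul_sum, ← Finset.sum_add_distrib, ← Finset.sum_sub_distrib]
      exact Finset.sum_congr rfl fun x _ => by ring
    linarith
  have h4 := Finset.sum_le_sum hs
  rw [Finset.sum_const, nsmul_eq_mul] at h4
  have h5 : h ⬝ᵥ B.mulVec h = (S.card : ℝ)⁻¹ * ∑ s ∈ S, ∑ x, h x * h (τ (x * s)) := by
    rw [Finset.sum_comm, Finset.mul_sum]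
    refine Finset.sum_congr rfl fun x _ => ?_
    rw [hBf, ← Finset.mul_sum]
    ring
  rw [h5, le_inv_mul_iff₀ (by exact_mod_cast hne.card_pos)]
  exact h4

/-- Converts `ℓ¹` almost invariance of counts into `ℓ²` almost invariance of their square roots. -/
theorem sq_sqrt_sub_sqrt_le_abs {a b : ℝ} (ha : 0 ≤ a) (hb : 0 ≤ b) :
    (√a - √b) ^ 2 ≤ |a - b| := by
  have h1 : a - b = (√a - √b) * (√a + √b) := by
    linear_combination -(Real.sq_sqrt ha) + Real.sq_sqrt hb
  have h2 : |√a - √b| ≤ √a + √b := by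
    rw [abs_le]
    constructor <;> linarith [Real.sqrt_nonneg a, Real.sqrt_nonneg b]
  rw [h1, abs_mul, abs_of_nonneg (by positivity : 0 ≤ √a + √b), ← sq_abs, sq]
  gcongr

/-! ### The contradiction -/

theorem mainTheorem10 {G : Type*} [Group G] (hG : IsAmenableGroup G)
    (A : Set G) (hA : A.Finite) (hgen : Subgroup.closure A = ⊤)
    (σ : MulAut G) (g : G) (hσ : σ = MulAut.conj g) (hσ2 : orderOf σ = 2)
    {ι : Type*} (Q : ι → Type*) [∀ i, Group (Q i)] [∀ i, Fintype (Q i)]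
    (π : ∀ i, G →* Q i) (hπ : ∀ i, Function.Surjective (π i))
    (hinf : (Set.range fun i => (π i).ker).Infinite) :
    ¬ IsExpanderFamily fun i =>
      twistedCayleyGraph (MulAut.conj (π i g)) (π i '' (A ∪ σ '' A⁻¹)) := by
  classical
  rintro ⟨ε, hε, hspec⟩
  have hσσ : ∀ x, σ (σ x) = x := fun x => by
    have : σ ^ 2 = 1 := hσ2 ▸ pow_orderOf_eq_one σ
    rw [← MulAut.mul_apply, ← sq, this, MulAut.one_apply]
  have hσg : ∀ x, σ x = g * x * g⁻¹ := fun x => by rw [hσ, MulAut.conj_apply]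
  -- A trivial group has no automorphism of order two.
  have hAne : A.Nonempty := by
    by_contra hempty
    rw [Set.not_nonempty_iff_eq_empty] at hempty
    rw [hempty, Subgroup.closure_empty] at hgen
    have hσ1 : σ = 1 := MulEquiv.ext fun x => by
      have hx : ∀ y : G, y = 1 := fun y => Subgroup.mem_bot.1 (hgen ▸ Subgroup.mem_top y)
      rw [hx (σ x), hx x, MulAut.one_apply]
    rw [hσ1, orderOf_one] at hσ2
    omega
  have hEfin : (A ∪ σ '' A⁻¹).Finite := hA.union (hA.inv.image _)
  set E : Finset G := hEfin.toFinset with hE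
  have hEcoe : (E : Set G) = A ∪ σ '' A⁻¹ := hEfin.coe_toFinset
  have hEinv : ∀ s ∈ E, σ s⁻¹ ∈ E := by
    intro s hs
    rw [hE, Set.Finite.mem_toFinset] at hs ⊢
    rcases hs with hs | ⟨a, ha, rfl⟩
    · exact Or.inr ⟨s⁻¹, by simpa using hs, rfl⟩
    · refine Or.inl ?_
      rw [← map_inv, hσσ]
      exact ha
  have hEne : E.Nonempty := by
    rw [← Finset.coe_nonempty, hEcoe]
    exact hAne.inl
  -- The two factors of `F × F` are moved by `g⁻¹` and `s * g⁻¹`. Two factors and two one-sided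
  -- differences turn `ε / 8` into `ε / 2`.
  obtain ⟨F, hF⟩ := hG.exists_folner (insert 1 (insert g⁻¹ (E.image (· * g⁻¹))))
    (by positivity : 0 < ε / 8)
  have hF0 : 0 < F.card := by
    by_contra h0
    have : F.card = 0 := by omega
    rw [this] at hF
    have h1 : (0 : ℝ) ≤ ((insert 1 (insert g⁻¹ (E.image (· * g⁻¹))) * F : Finset G).card : ℝ) :=
      Nat.cast_nonneg _
    simp only [Nat.cast_zero, mul_zero] at hF
    linarith
  obtain ⟨i, hi⟩ : ∃ i, 2 * F.card ^ 2 < Fintype.card (Q i) := by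
    by_contra! hn
    exact hinf (finite_range_ker_of_card_le hA hgen Q π _ hn)
  set τ := MulAut.conj (π i g) with hτdef
  have hτ : ∀ x, τ (π i x) = π i (σ x) := fun x => by rw [hτdef, conj_map_apply, hσ]
  have hττ : ∀ x, τ (τ x) = x := fun x => by
    obtain ⟨x, rfl⟩ := hπ i x
    rw [hτ, hτ, hσσ]
  let p : G × G → Q i := fun q => π i (q.1 * q.2⁻¹)
  let N : Q i → ℝ := fun y => (((F ×ˢ F).filter fun q => p q = y).card : ℝ)
  let h : Q i → ℝ := fun y => √(N y)
  have hN0 : ∀ y, 0 ≤ N y := fun y => Nat.cast_nonneg _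
  have hsq : ∑ y, h y ^ 2 = (F.card : ℝ) ^ 2 := by
    simp only [h, Real.sq_sqrt (hN0 _), N]
    rw [← Nat.cast_sum, ← Finset.card_eq_sum_card_fiberwise (f := p) (t := Finset.univ)
      fun _ _ => by simp, Finset.card_product]
    push_cast
    ring
  have hbound := twistedCayleyGraph_gap_bound τ hττ (E.image (π i))
    (by
      intro s hs
      obtain ⟨s, hsE, rfl⟩ := Finset.mem_image.1 hs
      rw [← map_inv, hτ]
      exact Finset.mem_image_of_mem _ (hEinv s hsE))
    (hEne.image _) (ε := ε)
    (by rw [Finset.coe_image, hEcoe]; exact hspec i) h (η := ε / 2)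
    (by
      intro s hs
      obtain ⟨s, hsE, rfl⟩ := Finset.mem_image.1 hs
      set P' : Finset (G × G) := (g⁻¹ • F) ×ˢ ((s * g⁻¹) • F) with hP'
      have hshift : ∀ x, N (τ (x * π i s)) = ((P'.filter fun q => p q = x).card : ℝ) := by
        intro x
        obtain ⟨x, rfl⟩ := hπ i x
        simp only [N]
        rw [← map_mul, hτ, hσg]
        congr 1
        refine Finset.card_bij (fun q _ => (g⁻¹ * q.1, s * g⁻¹ * q.2)) ?_ ?_ ?_
        · rintro ⟨a, b⟩ hq
          simp only [Finset.mem_filter, Finset.mem_product, p] at hq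
          simp only [Finset.mem_filter, hP', Finset.mem_product, p]
          refine ⟨⟨Finset.smul_mem_smul_finset hq.1.1, Finset.smul_mem_smul_finset hq.1.2⟩, ?_⟩
          have h1 : g⁻¹ * a * (s * g⁻¹ * b)⁻¹ = g⁻¹ * (a * b⁻¹) * (g * s⁻¹) := by group
          rw [h1, map_mul, map_mul, hq.2, ← map_mul, ← map_mul]
          congr 1
          group
        · rintro ⟨a, b⟩ _ ⟨a', b'⟩ _ hq
          simpa using hq
        · rintro ⟨a, b⟩ hq
          simp only [Finset.mem_filter, hP', Finset.mem_product, p] at hq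
          obtain ⟨⟨ha, hb⟩, hq⟩ := hq
          obtain ⟨a, haF, rfl⟩ := Finset.mem_smul_finset.1 ha
          obtain ⟨b, hbF, rfl⟩ := Finset.mem_smul_finset.1 hb
          refine ⟨(a, b), ?_, rfl⟩
          simp only [Finset.mem_filter, Finset.mem_product, p]
          refine ⟨⟨haF, hbF⟩, ?_⟩
          have h1 : g * (x * s) * g⁻¹ = g * x * (s * g⁻¹) := by group
          rw [h1, map_mul (π i) (g * x), map_mul (π i) g x, ← hq, ← map_mul, ← map_mul]
          congr 1
          simp only [smul_eq_mul]
          group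
      have hcard : (P' \ (F ×ˢ F)).card = ((F ×ˢ F) \ P').card := by
        have h2 := Finset.card_sdiff_add_card (F ×ˢ F) P'
        have h3 := Finset.card_sdiff_add_card P' (F ×ˢ F)
        have h4 : P'.card = (F ×ˢ F).card := by
          rw [hP', Finset.card_product, Finset.card_product, Finset.card_smul_finset,
            Finset.card_smul_finset]
        rw [Finset.union_comm] at h2
        omega
      have hg := (card_sdiff_smul_le hF.le (by simp) (k := g⁻¹) (by simp)).1
      have hsg := (card_sdiff_smul_le hF.le (by simp) (k := s * g⁻¹)
        (by simp only [Finset.mem_insert, Finset.mem_image]; exact Or.inr (Or.inr ⟨s, hsE, rfl⟩))).1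
      have hP : (((F ×ˢ F) \ P').card : ℝ) ≤ ε / 4 * (F.card : ℝ) ^ 2 := by
        have h1 : (((F ×ˢ F) \ P').card : ℝ) ≤ ((F \ (g⁻¹ • F)).card : ℝ) * F.card +
            F.card * ((F \ ((s * g⁻¹) • F)).card : ℝ) := by
          exact_mod_cast card_product_sdiff_le F (g⁻¹ • F) ((s * g⁻¹) • F)
        nlinarith [(Nat.cast_nonneg F.card : (0 : ℝ) ≤ F.card)]
      calc ∑ x, (h x - h (τ (x * π i s))) ^ 2
          ≤ ∑ x, |N x - N (τ (x * π i s))| :=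
            Finset.sum_le_sum fun x _ => sq_sqrt_sub_sqrt_le_abs (hN0 _) (hN0 _)
        _ ≤ (((F ×ˢ F) \ P').card : ℝ) + ((P' \ (F ×ˢ F)).card : ℝ) := by
            simp only [hshift]
            exact sum_abs_card_fiber_sub_le p (F ×ˢ F) P'
        _ ≤ ε / 2 * ∑ x, h x ^ 2 := by
            rw [hcard, hsq]
            linarith)
  have hsum : (∑ y, h y) ^ 2 ≤ (F.card : ℝ) ^ 2 * ∑ y, h y ^ 2 := by
    set T := (F ×ˢ F).image p with hT
    have hzero : ∀ y, y ∉ T → h y = 0 := by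
      intro y hy
      simp only [h, N]
      rw [Finset.filter_eq_empty_iff.2 fun q hq hqy => hy (Finset.mem_image.2 ⟨q, hq, hqy⟩)]
      simp
    rw [← Finset.sum_subset (Finset.subset_univ T) fun y _ hy => hzero y hy]
    have hTcard : (T.card : ℝ) ≤ (F.card : ℝ) ^ 2 := by
      have := Finset.card_image_le (s := F ×ˢ F) (f := p)
      rw [Finset.card_product, ← sq] at this
      exact_mod_cast this
    refine sq_sum_le_card_mul_sum_sq.trans ?_
    refine mul_le_mul hTcard ?_ (Finset.sum_nonneg fun _ _ => sq_nonneg _) (sq_nonneg _)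
    exact Finset.sum_le_sum_of_subset_of_nonneg (Finset.subset_univ T) fun _ _ _ => sq_nonneg _
  have hF1 : (0 : ℝ) < (F.card : ℝ) ^ 2 := by positivity
  have hi' : 2 * (F.card : ℝ) ^ 2 < Fintype.card (Q i) := by exact_mod_cast hi
  have hlast : ε / Fintype.card (Q i) * (∑ y, h y) ^ 2 ≤ ε / 2 * (F.card : ℝ) ^ 2 := by
    rw [hsq] at hsum
    rw [div_mul_eq_mul_div, div_le_iff₀ (by linarith)]
    nlinarith [mul_le_mul_of_nonneg_left hsum hε.le, mul_lt_mul_of_pos_left hi' (mul_pos hε hF1)]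
  -- What remains is `1 - ε / 4 ≤ 1 - ε / 2`, multiplied by `|F|² > 0`.
  rw [hsq] at hbound
  nlinarith [mul_pos hε hF1]
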